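/- Let $\mathbb H=\{z\in\mathbb C:\operatorname{Re} z>0\}$, and let $H^2(\mathbb H)$ be the space of analytic functions $V$ on $\mathbb H$ with $\sup_{x>0}\int_{\mathbb R}|V(x+iy)|^2\,dy<\infty$. An analytic function $V$ on $\mathbb H$ is called outer if the boundary values $V(iy):=\lim_{x\downarrow 0}V(x+iy)$ exist and are nonzero for almost every $y\in\mathbb R$, $\int_{\mathbb R}\bigl|\log|V(iy)|\bigr|\,\frac{dy}{1+y^2}<\infty$, and $|V(z)|=|O_V(z)|$ for all $z\in\mathbb H$, where $$O_V(z):=\exp\biggl\{\int_{\mathbb R}\log|V(it)|\Bigl[\frac1{z-it}-\frac{it}{1+t^2}\Bigr]\frac{dt}{\pi}\biggr\}.$$ Suppose that $V\in H^2(\mathbb H)$ is not identically zero and that, for some $n\in\mathbb N=\{0,1,2,\dots\}$, the function $W(z):=(1+z)^{-n}/V(z)$ belongs to $H^2(\mathbb H)$. Then $V$ is an outer function. -/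

import Mathlib

open MeasureTheory Filter Topology

noncomputable section

/-- The open right half-plane `{z : Re z > 0}`. -/
def rightHalfPlane : Set ℂ := {z : ℂ | 0 < z.re}

/-- Membership in the Hardy space `H²` of the right half-plane. Only the values of `V` on the
half-plane matter. -/
structure MemHardyTwo (V : ℂ → ℂ) : Prop where
  analytic : AnalyticOnNhd ℂ V rightHalfPlane
  sup_lt_top :
    (⨆ x ∈ Set.Ioi (0 : ℝ), ∫⁻ y : ℝ, ‖V ((x : ℂ) + (y : ℂ) * Complex.I)‖ₑ ^ 2) < ⊤

/-- The boundary value `V(iy) = lim_{x ↓ 0} V(x + iy)`; meaningful where the limit exists. -/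
def boundaryValue (V : ℂ → ℂ) (y : ℝ) : ℂ :=
  limUnder (𝓝[>] (0 : ℝ)) (fun x : ℝ => V ((x : ℂ) + (y : ℂ) * Complex.I))

/-- The function
`O_V(z) = exp (∫ log |V(it)| [1 / (z - it) - it / (1 + t²)] dt / π)`. -/
def outerPart (V : ℂ → ℂ) (z : ℂ) : ℂ :=
  Complex.exp (∫ t : ℝ, (Real.log ‖boundaryValue V t‖ : ℂ) *
    (1 / (z - (t : ℂ) * Complex.I) - (t : ℂ) * Complex.I / (1 + (t : ℂ) ^ 2)) / (Real.pi : ℂ))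

/-- `V` is outer: it is analytic on the right half-plane, `O_V` is well defined (the boundary
values exist and are nonzero almost everywhere and `log |V(iy)|` is integrable against
`dy / (1 + y²)`), and `|V| = |O_V|` throughout the half-plane. -/
structure IsOuterFunction (V : ℂ → ℂ) : Prop where
  analytic : AnalyticOnNhd ℂ V rightHalfPlane
  tendsto_boundaryValue : ∀ᵐ y : ℝ,
    Tendsto (fun x : ℝ => V ((x : ℂ) + (y : ℂ) * Complex.I)) (𝓝[>] (0 : ℝ))
      (𝓝 (boundaryValue V y))
  boundaryValue_ne_zero : ∀ᵐ y : ℝ, boundaryValue V y ≠ 0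
  integrable_log : Integrable (fun y : ℝ => Real.log ‖boundaryValue V y‖ / (1 + y ^ 2))
  norm_eq : ∀ z ∈ rightHalfPlane, ‖V z‖ = ‖outerPart V z‖

end

/-!
Where `|V W|` is not too small, both `log |V|` and `-log |V|` are controlled by `|V| + |W|` up to a
term of slow growth. Elements of `H²` are bounded on each half-plane `Re z ≥ x > 0`, so `log |V|`
grows sublinearly there, and exhausting the half-plane by discs tangent to its boundary shows that
each translate `z ↦ log |V(x + z)|` is the Poisson integral of its boundary values. These boundary
values stay bounded in `L²(dt / (1 + t²))` as `x ↓ 0`, because `V` and `W` lie in `H²`; a weak limit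
`φ` then represents `log |V|` itself as a Poisson integral, which excludes any singular part.
Fatou's theorem identifies `φ` with `log |V(iy)|`, and exponentiating gives `|V| = |O_V|`.
-/

noncomputable section

/-! ### Harmonic measure and Fatou's theorem -/

open ProbabilityTheory
open scoped ENNReal

/-- The Poisson kernel of the right half-plane at the boundary point `it`. -/
def poissonDensity (z : ℂ) (t : ℝ) : ℝ :=
  z.re / (Real.pi * (z.re ^ 2 + (t - z.im) ^ 2))

/-- The harmonic measure of the right half-plane seen from `z`, a measure on `ℝ` through the
parametrisation `t ↦ it` of the boundary. It is a Cauchy distribution. -/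
def harmonicMeasure (z : ℂ) : Measure ℝ :=
  cauchyMeasure z.im z.re.toNNReal

instance (z : ℂ) : IsProbabilityMeasure (harmonicMeasure z) := by
  unfold harmonicMeasure
  infer_instance

variable {z : ℂ} {E : Type*} [NormedAddCommGroup E]

lemma poissonDensity_pos (hz : 0 < z.re) (t : ℝ) : 0 < poissonDensity z t := by
  unfold poissonDensity
  positivity

lemma continuous_poissonDensity (hz : 0 < z.re) : Continuous (poissonDensity z) := by
  unfold poissonDensity
  exact continuous_const.div (by fun_prop) fun t => by positivity

lemma poissonDensity_one (t : ℝ) : poissonDensity 1 t = (Real.pi * (1 + t ^ 2))⁻¹ := by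
  simp [poissonDensity]

lemma harmonicMeasure_eq_withDensity (hz : 0 < z.re) :
    harmonicMeasure z = volume.withDensity fun t => ENNReal.ofReal (poissonDensity z t) := by
  rw [harmonicMeasure, cauchyMeasure_of_scale_ne_zero _ (by simpa using hz)]
  congr 1 with t
  rw [cauchyPDF_def, cauchyPDFReal_def, Real.coe_toNNReal _ hz.le, poissonDensity, add_comm]
  congr 1
  field_simp

lemma lintegral_harmonicMeasure (hz : 0 < z.re) {f : ℝ → ℝ≥0∞} (hf : AEMeasurable f) :
    ∫⁻ t, f t ∂harmonicMeasure z = ∫⁻ t, ENNReal.ofReal (poissonDensity z t) * f t := by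
  rw [harmonicMeasure_eq_withDensity hz]
  exact lintegral_withDensity_eq_lintegral_mul₀
    (continuous_poissonDensity hz).measurable.ennreal_ofReal.aemeasurable hf

lemma integral_harmonicMeasure [NormedSpace ℝ E] (hz : 0 < z.re) (f : ℝ → E) :
    ∫ t, f t ∂harmonicMeasure z = ∫ t, poissonDensity z t • f t := by
  rw [harmonicMeasure_eq_withDensity hz, integral_withDensity_eq_integral_toReal_smul
    (continuous_poissonDensity hz).measurable.ennreal_ofReal (by simp)]
  simp only [ENNReal.toReal_ofReal (poissonDensity_pos hz _).le]

lemma integrable_harmonicMeasure_iff [NormedSpace ℝ E] (hz : 0 < z.re) {f : ℝ → E} :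
    Integrable f (harmonicMeasure z) ↔ Integrable fun t => poissonDensity z t • f t := by
  rw [harmonicMeasure_eq_withDensity hz, integrable_withDensity_iff_integrable_smul'
    (continuous_poissonDensity hz).measurable.ennreal_ofReal (by simp)]
  simp only [ENNReal.toReal_ofReal (poissonDensity_pos hz _).le]

lemma harmonicMeasure_absolutelyContinuous (hz : 0 < z.re) : harmonicMeasure z ≪ volume := by
  rw [harmonicMeasure_eq_withDensity hz]
  exact withDensity_absolutelyContinuous _ _

lemma harmonicMeasure_one_le_volume : harmonicMeasure 1 ≤ volume := by
  calc harmonicMeasure 1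
      = volume.withDensity fun t => ENNReal.ofReal (poissonDensity 1 t) :=
        harmonicMeasure_eq_withDensity (by simp)
    _ ≤ volume.withDensity 1 := ?_
    _ = volume := withDensity_one
  refine withDensity_mono (ae_of_all _ fun t => ENNReal.ofReal_le_one.2 ?_)
  rw [poissonDensity_one]
  exact inv_le_one_of_one_le₀ (by nlinarith [Real.pi_gt_three, sq_nonneg t])

lemma locallyIntegrable_of_integrable_harmonicMeasure [NormedSpace ℝ E] (hz : 0 < z.re)
    {f : ℝ → E} (hf : Integrable f (harmonicMeasure z)) : LocallyIntegrable f := by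
  have h := ((integrable_harmonicMeasure_iff hz).1 hf).locallyIntegrable
  have hinv : Continuous fun t => (poissonDensity z t)⁻¹ :=
    (continuous_poissonDensity hz).inv₀ fun t => (poissonDensity_pos hz t).ne'
  have hf' := (h.locallyIntegrableOn Set.univ).continuousOn_smul isOpen_univ.isLocallyClosed
    hinv.continuousOn
  rw [← locallyIntegrableOn_univ]
  exact hf'.congr (ae_of_all _ fun t => inv_smul_smul₀ (poissonDensity_pos hz t).ne' _)

lemma poissonDensity_le_mul_poissonDensity_one (hz : 0 < z.re) {δ t : ℝ} (hδ : 0 < δ)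
    (ht : δ ^ 2 ≤ z.re ^ 2 + (t - z.im) ^ 2) :
    poissonDensity z t ≤ z.re * (2 + (1 + 2 * z.im ^ 2) / δ ^ 2) * poissonDensity 1 t := by
  set q := z.re ^ 2 + (t - z.im) ^ 2 with hq
  have : 0 < q := by positivity
  have hconst : 1 + 2 * z.im ^ 2 ≤ (1 + 2 * z.im ^ 2) / δ ^ 2 * q := by
    rw [div_mul_eq_mul_div, le_div_iff₀ (by positivity)]
    gcongr
  have hquad : 1 + t ^ 2 ≤ (2 + (1 + 2 * z.im ^ 2) / δ ^ 2) * q := by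
    nlinarith [sq_nonneg (t - 2 * z.im), sq_nonneg z.re]
  rw [poissonDensity_one, poissonDensity, ← hq, ← div_eq_mul_inv,
    div_le_div_iff₀ (by positivity) (by positivity)]
  calc z.re * (Real.pi * (1 + t ^ 2))
      ≤ z.re * (Real.pi * ((2 + (1 + 2 * z.im ^ 2) / δ ^ 2) * q)) := by gcongr
    _ = _ := by ring

lemma setLIntegral_harmonicMeasure_le (hz : 0 < z.re) {δ : ℝ} (hδ : 0 < δ) {s : Set ℝ}
    (hs : MeasurableSet s) (hsδ : ∀ t ∈ s, δ ^ 2 ≤ z.re ^ 2 + (t - z.im) ^ 2)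
    {f : ℝ → ℝ≥0∞} (hf : AEMeasurable f) :
    ∫⁻ t in s, f t ∂harmonicMeasure z ≤
      ENNReal.ofReal (z.re * (2 + (1 + 2 * z.im ^ 2) / δ ^ 2)) * ∫⁻ t, f t ∂harmonicMeasure 1 := by
  have hone : (0 : ℝ) < (1 : ℂ).re := by simp
  rw [← lintegral_indicator hs, lintegral_harmonicMeasure hz (hf.indicator hs),
    lintegral_harmonicMeasure hone hf, ← lintegral_const_mul' _ _ ENNReal.ofReal_ne_top]
  refine lintegral_mono fun t => ?_
  by_cases ht : t ∈ s
  · rw [Set.indicator_of_mem ht, ← mul_assoc, ← ENNReal.ofReal_mul (by positivity)]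
    gcongr
    exact poissonDensity_le_mul_poissonDensity_one hz hδ (hsδ t ht)
  · simp [ht]

lemma exists_harmonicMeasure_le_smul (hz : 0 < z.re) :
    ∃ C : ℝ≥0∞, C ≠ ∞ ∧ harmonicMeasure z ≤ C • harmonicMeasure 1 := by
  refine ⟨ENNReal.ofReal (z.re * (2 + (1 + 2 * z.im ^ 2) / z.re ^ 2)), ENNReal.ofReal_ne_top,
    Measure.le_iff.2 fun s hs => ?_⟩
  have h := setLIntegral_harmonicMeasure_le hz hz MeasurableSet.univ
    (fun t _ => by nlinarith [sq_nonneg (t - z.im)])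
    (measurable_one.indicator hs).aemeasurable
  rwa [Measure.restrict_univ, lintegral_indicator_one hs, lintegral_indicator_one hs] at h

lemma integrable_harmonicMeasure_of_one (hz : 0 < z.re) {f : ℝ → E}
    (hf : Integrable f (harmonicMeasure 1)) : Integrable f (harmonicMeasure z) :=
  let ⟨_, hC, hle⟩ := exists_harmonicMeasure_le_smul hz
  hf.of_measure_le_smul hC hle

lemma setOf_le_poissonDensity (hz : 0 < z.re) {l : ℝ} (hl : 0 < l) :
    {t | l ≤ poissonDensity z t} = ∅ ∨
      ∃ r, 0 ≤ r ∧ {t | l ≤ poissonDensity z t} = Metric.closedBall z.im r := by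
  have hsub : {t | l ≤ poissonDensity z t}
      = {t | (t - z.im) ^ 2 ≤ z.re / (Real.pi * l) - z.re ^ 2} := by
    ext t
    rw [Set.mem_ofPred_eq, Set.mem_ofPred_eq, poissonDensity, le_div_iff₀ (by positivity),
      le_sub_iff_add_le, le_div_iff₀ (by positivity)]
    constructor <;> intro h <;> linarith
  rcases lt_or_ge (z.re / (Real.pi * l) - z.re ^ 2) 0 with h | h
  · refine .inl (Set.eq_empty_of_forall_notMem fun t ht => ?_)
    rw [hsub] at ht
    exact (h.trans_le (sq_nonneg (t - z.im))).not_ge ht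
  · refine .inr ⟨√(z.re / (Real.pi * l) - z.re ^ 2), Real.sqrt_nonneg _, ?_⟩
    ext t
    rw [hsub, Set.mem_ofPred_eq, Metric.mem_closedBall, Real.dist_eq, ← sq_abs,
      Real.le_sqrt (abs_nonneg _) h]

/- Layer-cake: the superlevel sets of the Poisson kernel are balls centred at `z.im`. -/
lemma lintegral_poissonDensity_le (hz : 0 < z.re) {ν : Measure ℝ} {ε : ℝ≥0∞}
    (hν : ∀ r, 0 ≤ r → ν (Metric.closedBall z.im r) ≤ ε * volume (Metric.closedBall z.im r)) :
    ∫⁻ t, ENNReal.ofReal (poissonDensity z t) ∂ν ≤ ε := by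
  have hnonneg t : 0 ≤ poissonDensity z t := (poissonDensity_pos hz t).le
  have hmeas := (continuous_poissonDensity hz).measurable
  have hlevel : ∀ l ∈ Set.Ioi (0 : ℝ),
      ν {t | l ≤ poissonDensity z t} ≤ ε * volume {t | l ≤ poissonDensity z t} := by
    intro l hl
    rcases setOf_le_poissonDensity hz hl with h | ⟨r, hr, h⟩
    · simp [h]
    · simpa only [h] using hν r hr
  calc ∫⁻ t, ENNReal.ofReal (poissonDensity z t) ∂ν
      = ∫⁻ l in Set.Ioi (0 : ℝ), ν {t | l ≤ poissonDensity z t} :=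
        lintegral_eq_lintegral_meas_le ν (ae_of_all _ hnonneg) hmeas.aemeasurable
    _ ≤ ∫⁻ l in Set.Ioi (0 : ℝ), ε * volume {t | l ≤ poissonDensity z t} :=
        setLIntegral_mono' measurableSet_Ioi hlevel
    _ = ε * ∫⁻ l in Set.Ioi (0 : ℝ), volume {t | l ≤ poissonDensity z t} :=
        lintegral_const_mul _ (Antitone.measurable fun a b hab =>
          measure_mono fun t (ht : b ≤ _) => hab.trans ht)
    _ = ε * ∫⁻ t, ENNReal.ofReal (poissonDensity z t) := by
        rw [lintegral_eq_lintegral_meas_le volume (ae_of_all _ hnonneg) hmeas.aemeasurable]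
    _ = ε := by
        have h := lintegral_harmonicMeasure hz (aemeasurable_const (b := (1 : ℝ≥0∞)))
        simp only [lintegral_const, measure_univ, mul_one] at h
        rw [← h, mul_one]

lemma setLIntegral_closedBall_harmonicMeasure_le (hz : 0 < z.re) {f : ℝ → ℝ≥0∞}
    (hf : AEMeasurable f) {δ : ℝ} {ε : ℝ≥0∞}
    (hε : ∀ r, 0 ≤ r → r ≤ δ →
      ∫⁻ t in Metric.closedBall z.im r, f t ≤ ε * volume (Metric.closedBall z.im r))
    (hδ : 0 ≤ δ) :
    ∫⁻ t in Metric.closedBall z.im δ, f t ∂harmonicMeasure z ≤ ε := by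
  have hball (r : ℝ) : MeasurableSet (Metric.closedBall z.im r) :=
    Metric.isClosed_closedBall.measurableSet
  set ν := (volume.restrict (Metric.closedBall z.im δ)).withDensity f with hν
  have hle : ∫⁻ t, ENNReal.ofReal (poissonDensity z t) ∂ν ≤ ε := by
    refine lintegral_poissonDensity_le hz fun r hr => ?_
    have hinter : Metric.closedBall z.im r ∩ Metric.closedBall z.im δ
        = Metric.closedBall z.im (min r δ) := by
      ext t
      simp
    rw [hν, withDensity_apply _ (hball r), Measure.restrict_restrict (hball r), hinter]
    refine (hε _ (le_min hr hδ) (min_le_right _ _)).trans ?_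
    gcongr
    exact min_le_left _ _
  rw [hν, lintegral_withDensity_eq_lintegral_mul₀ hf.restrict
    (continuous_poissonDensity hz).measurable.ennreal_ofReal.aemeasurable] at hle
  rw [harmonicMeasure_eq_withDensity hz, restrict_withDensity (hball δ),
    lintegral_withDensity_eq_lintegral_mul₀
      (continuous_poissonDensity hz).measurable.ennreal_ofReal.aemeasurable hf.restrict]
  simpa only [mul_comm] using hle

lemma exists_setLIntegral_closedBall_le_of_tendsto_average {f : ℝ → E} {y : ℝ}
    (hf : LocallyIntegrable f)
    (hy : Tendsto (fun r => ⨍ t in Metric.closedBall y r, ‖f t - f y‖) (𝓝[>] 0) (𝓝 0))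
    {ε : ℝ} (hε : 0 < ε) :
    ∃ δ > 0, ∀ r, 0 ≤ r → r ≤ δ → ∫⁻ t in Metric.closedBall y r, ‖f t - f y‖ₑ
      ≤ ENNReal.ofReal ε * volume (Metric.closedBall y r) := by
  obtain ⟨δ, hδ, hsub⟩ := mem_nhdsGT_iff_exists_Ioc_subset.1 (hy.eventually (gt_mem_nhds hε))
  refine ⟨δ, hδ, fun r hr0 hr => ?_⟩
  rcases hr0.eq_or_lt with rfl | hr0
  · simp
  have hvol : 0 < volume.real (Metric.closedBall y r) := by
    rw [Real.volume_real_closedBall hr0.le]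
    positivity
  have hint : IntegrableOn (fun t => f t - f y) (Metric.closedBall y r) :=
    (hf.integrableOn_isCompact (isCompact_closedBall _ _)).sub
      (continuousOn_const.integrableOn_compact (isCompact_closedBall _ _))
  have hlt : ∫ t in Metric.closedBall y r, ‖f t - f y‖
      < volume.real (Metric.closedBall y r) * ε := by
    have h : ⨍ t in Metric.closedBall y r, ‖f t - f y‖ < ε := hsub ⟨hr0, hr⟩
    rwa [setAverage_eq, smul_eq_mul, inv_mul_lt_iff₀ hvol] at h
  calc ∫⁻ t in Metric.closedBall y r, ‖f t - f y‖ₑ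
      = ENNReal.ofReal (∫ t in Metric.closedBall y r, ‖f t - f y‖) :=
        (ofReal_integral_norm_eq_lintegral_enorm hint).symm
    _ ≤ ENNReal.ofReal (ε * volume.real (Metric.closedBall y r)) :=
        ENNReal.ofReal_le_ofReal (by linarith)
    _ = ENNReal.ofReal ε * volume (Metric.closedBall y r) := by
        rw [ENNReal.ofReal_mul hε.le, ofReal_measureReal measure_closedBall_lt_top.ne]

lemma tendsto_lintegral_enorm_sub_harmonicMeasure {f : ℝ → E} {y : ℝ} (hf : LocallyIntegrable f)
    (hint : ∫⁻ t, ‖f t - f y‖ₑ ∂harmonicMeasure 1 ≠ ∞)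
    (hy : Tendsto (fun r => ⨍ t in Metric.closedBall y r, ‖f t - f y‖) (𝓝[>] 0) (𝓝 0)) :
    Tendsto (fun x : ℝ => ∫⁻ t, ‖f t - f y‖ₑ ∂harmonicMeasure (x + y * Complex.I))
      (𝓝[>] 0) (𝓝 0) := by
  have hmeas : AEMeasurable fun t => ‖f t - f y‖ₑ :=
    (hf.aestronglyMeasurable.sub aestronglyMeasurable_const).enorm
  refine ENNReal.tendsto_nhds_zero.2 fun ε hε => ?_
  obtain ⟨η, hη, hηε⟩ : ∃ η : ℝ, 0 < η ∧ ENNReal.ofReal η < ε := by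
    obtain ⟨η, _, hηε⟩ := ENNReal.lt_iff_exists_real_btwn.1 hε
    exact ⟨η, ENNReal.ofReal_pos.1 hηε.1, hηε.2⟩
  obtain ⟨δ, hδ, hball⟩ := exists_setLIntegral_closedBall_le_of_tendsto_average hf hy hη
  have hfar : Tendsto (fun x : ℝ => ENNReal.ofReal (x * (2 + (1 + 2 * y ^ 2) / δ ^ 2)) *
      ∫⁻ t, ‖f t - f y‖ₑ ∂harmonicMeasure 1) (𝓝[>] 0) (𝓝 0) := by
    have h : Tendsto (fun x : ℝ => x * (2 + (1 + 2 * y ^ 2) / δ ^ 2)) (𝓝[>] 0) (𝓝 0) :=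
      ((continuous_mul_const _).tendsto' 0 0 (zero_mul _)).mono_left nhdsWithin_le_nhds
    simpa using ENNReal.Tendsto.mul_const (ENNReal.tendsto_ofReal h) (.inr hint)
  filter_upwards [hfar.eventually (gt_mem_nhds (tsub_pos_of_lt hηε)), self_mem_nhdsWithin]
    with x hx (hx0 : 0 < x)
  have hre : (x + y * Complex.I : ℂ).re = x := by simp
  have him : (x + y * Complex.I : ℂ).im = y := by simp
  have hz : 0 < (x + y * Complex.I : ℂ).re := by rwa [hre]
  have hnear := setLIntegral_closedBall_harmonicMeasure_le hz hmeas (by rwa [him]) hδ.le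
  have hcompl := setLIntegral_harmonicMeasure_le hz hδ
    (Metric.isClosed_closedBall (x := y) (ε := δ)).measurableSet.compl (fun t ht => by
      rw [Set.mem_compl_iff, Metric.mem_closedBall, not_le, Real.dist_eq] at ht
      rw [him, ← sq_abs (t - y)]
      nlinarith [sq_nonneg (x + y * Complex.I : ℂ).re]) hmeas
  rw [hre, him] at hcompl
  rw [him] at hnear
  calc ∫⁻ t, ‖f t - f y‖ₑ ∂harmonicMeasure (x + y * Complex.I)
      = _ := (lintegral_add_compl _ Metric.isClosed_closedBall.measurableSet).symm
    _ ≤ ENNReal.ofReal η + (ε - ENNReal.ofReal η) := add_le_add hnear (hcompl.trans hx.le)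
    _ = ε := add_tsub_cancel_of_le hηε.le

theorem ae_tendsto_integral_harmonicMeasure [NormedSpace ℝ E] [CompleteSpace E] {f : ℝ → E}
    (hf : Integrable f (harmonicMeasure 1)) :
    ∀ᵐ y : ℝ, Tendsto (fun x : ℝ => ∫ t, f t ∂harmonicMeasure (x + y * Complex.I))
      (𝓝[>] 0) (𝓝 (f y)) := by
  have hloc := locallyIntegrable_of_integrable_harmonicMeasure (by simp) hf
  filter_upwards [IsUnifLocDoublingMeasure.ae_tendsto_average_norm_sub volume hloc 1] with y hleb
  have hy := hleb (l := 𝓝[>] 0) (fun _ => y) id tendsto_id (by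
    filter_upwards [self_mem_nhdsWithin] with r hr
    simpa using (Set.mem_Ioi.1 hr).le)
  have hsub : Integrable (fun t => f t - f y) (harmonicMeasure 1) := hf.sub (integrable_const _)
  refine tendsto_iff_edist_tendsto_0.2 (tendsto_of_tendsto_of_tendsto_of_le_of_le'
    tendsto_const_nhds (tendsto_lintegral_enorm_sub_harmonicMeasure hloc hsub.2.ne hy)
    (Eventually.of_forall fun _ => zero_le) ?_)
  filter_upwards [self_mem_nhdsWithin] with x (hx : 0 < x)
  have hint := integrable_harmonicMeasure_of_one
    (by simpa using hx : 0 < (x + y * Complex.I : ℂ).re) hf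
  calc edist (∫ t, f t ∂harmonicMeasure (x + y * Complex.I)) (f y)
      = ‖∫ t, (f t - f y) ∂harmonicMeasure (x + y * Complex.I)‖ₑ := by
        rw [integral_sub hint (integrable_const _), integral_const, probReal_univ, one_smul,
          edist_eq_enorm_sub]
    _ ≤ _ := enorm_integral_le_lintegral_enorm _

/-! ### Poisson representation by tangent discs -/

/-- The conformal map of the right half-plane onto the disc of radius `r` centred at `r`, tangent to
the boundary at `0`; it sends `2r` to the centre and converges to the identity as `r → ∞`. -/
def tangentDiscMap (r : ℝ) (a : ℂ) : ℂ :=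
  2 * r * a / (2 * r + a)

lemma two_mul_add_ne_zero {r : ℝ} (hr : 0 < r) {a : ℂ} (ha : 0 ≤ a.re) : 2 * (r : ℂ) + a ≠ 0 := by
  intro h
  have hre : 2 * r + a.re = 0 := by simpa using congrArg Complex.re h
  linarith

lemma two_mul_le_norm_two_mul_add {r : ℝ} {a : ℂ} (ha : 0 ≤ a.re) : 2 * r ≤ ‖2 * (r : ℂ) + a‖ := by
  refine le_trans ?_ (Complex.re_le_norm _)
  simpa using ha

lemma norm_tangentDiscMap_le {r : ℝ} (hr : 0 < r) {a : ℂ} (ha : 0 ≤ a.re) :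
    ‖tangentDiscMap r a‖ ≤ ‖a‖ := by
  rw [tangentDiscMap, norm_div, norm_mul,
    div_le_iff₀ (norm_pos_iff.2 (two_mul_add_ne_zero hr ha)), mul_comm]
  gcongr
  simpa [abs_of_pos hr] using two_mul_le_norm_two_mul_add (r := r) ha

lemma re_tangentDiscMap_nonneg {r : ℝ} (hr : 0 < r) {a : ℂ} (ha : 0 ≤ a.re) :
    0 ≤ (tangentDiscMap r a).re := by
  have h : (tangentDiscMap r a).re = 2 * r * (a.re * (2 * r) + Complex.normSq a) /
      Complex.normSq (2 * r + a) := by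
    simp only [tangentDiscMap, Complex.div_re, Complex.mul_re, Complex.re_ofNat, Complex.ofReal_re,
      Complex.im_ofNat, Complex.ofReal_im, mul_zero, sub_zero, Complex.mul_im, zero_mul, add_zero,
      Complex.add_re, Complex.normSq_apply, Complex.add_im, zero_add]
    ring
  rw [h]
  have := Complex.normSq_nonneg a
  have := Complex.normSq_nonneg (2 * r + a)
  positivity

lemma continuous_tangentDiscMap_mul_I {r : ℝ} (hr : 0 < r) :
    Continuous fun t : ℝ => tangentDiscMap r (t * Complex.I) :=
  Continuous.div (by fun_prop) (by fun_prop) fun t => two_mul_add_ne_zero hr (by simp)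

lemma tendsto_tangentDiscMap {a : ℂ} (ha : 0 ≤ a.re) :
    Tendsto (fun r => tangentDiscMap r a) atTop (𝓝 a) := by
  refine tendsto_iff_norm_sub_tendsto_zero.2 (squeeze_zero' (g := fun r => ‖a‖ ^ 2 / (2 * r))
    (Eventually.of_forall fun _ => norm_nonneg _) ?_
    (tendsto_const_nhds.div_atTop (tendsto_id.const_mul_atTop two_pos)))
  filter_upwards [eventually_gt_atTop 0] with r hr
  have hsub : tangentDiscMap r a - a = -a ^ 2 / (2 * r + a) := by
    rw [tangentDiscMap, div_sub' (two_mul_add_ne_zero hr ha)]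
    ring
  rw [hsub, norm_div, norm_neg, norm_pow]
  gcongr
  exact two_mul_le_norm_two_mul_add ha

lemma exp_pi_sub_two_mul_arctan_mul_I (s : ℝ) :
    Complex.exp ((Real.pi - 2 * Real.arctan s : ℝ) * Complex.I)
      = (s * Complex.I - 1) / (s * Complex.I + 1) := by
  set a := Real.arctan s with ha
  have hcos : (Real.cos a : ℂ) ≠ 0 := mod_cast (Real.cos_arctan_pos s).ne'
  have hsin : (Real.sin a : ℂ) = s * Real.cos a := by
    rw [ha, Real.sin_arctan, Real.cos_arctan]
    push_cast
    ring
  have hplus : (s * Complex.I + 1) * Real.cos a = Complex.exp (a * Complex.I) := by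
    rw [Complex.exp_mul_I, ← Complex.ofReal_cos, ← Complex.ofReal_sin, hsin]
    ring
  have hminus : (s * Complex.I - 1) * Real.cos a = -Complex.exp (-(a * Complex.I)) := by
    rw [← neg_mul, Complex.exp_mul_I, Complex.cos_neg, Complex.sin_neg, ← Complex.ofReal_cos,
      ← Complex.ofReal_sin, hsin]
    ring
  have hexp : Complex.exp ((Real.pi - 2 * a : ℝ) * Complex.I)
      = -Complex.exp (-(a * Complex.I)) / Complex.exp (a * Complex.I) := by
    rw [neg_div, ← Complex.exp_sub, ← Complex.exp_add_pi_mul_I]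
    congr 1
    push_cast
    ring
  rw [hexp, ← hplus, ← hminus, mul_div_mul_right _ _ hcos]

lemma circleMap_pi_sub_two_mul_arctan {r : ℝ} (hr : 0 < r) (c : ℂ) (t : ℝ) :
    circleMap (c + r) r (Real.pi - 2 * Real.arctan (t / (2 * r)))
      = c + tangentDiscMap r (t * Complex.I) := by
  have hr' : (r : ℂ) ≠ 0 := mod_cast hr.ne'
  have hne : 2 * (r : ℂ) + t * Complex.I ≠ 0 := two_mul_add_ne_zero hr (by simp)
  have hcayley : ((t / (2 * r) : ℝ) * Complex.I - 1) / ((t / (2 * r) : ℝ) * Complex.I + 1)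
      = (t * Complex.I - 2 * r) / (2 * r + t * Complex.I) := by
    rw [← mul_div_mul_left _ _ (mul_ne_zero two_ne_zero hr')]
    push_cast
    congr 1 <;> field_simp
    ring
  rw [circleMap, exp_pi_sub_two_mul_arctan_mul_I, hcayley, tangentDiscMap, add_assoc]
  congr 1
  rw [eq_div_iff hne, add_mul, mul_assoc, div_mul_cancel₀ _ hne]
  ring

lemma image_univ_pi_sub_two_mul_arctan {r : ℝ} (hr : 0 < r) :
    (fun t : ℝ => Real.pi - 2 * Real.arctan (t / (2 * r))) '' Set.univ
      = Set.Ioo 0 (2 * Real.pi) := by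
  ext θ
  simp only [Set.image_univ, Set.mem_range, Set.mem_Ioo]
  constructor
  · rintro ⟨t, rfl⟩
    have := Real.arctan_lt_pi_div_two (t / (2 * r))
    have := Real.neg_pi_div_two_lt_arctan (t / (2 * r))
    constructor <;> linarith
  · rintro ⟨h0, h1⟩
    refine ⟨Real.tan ((Real.pi - θ) / 2) * (2 * r), ?_⟩
    rw [mul_div_cancel_right₀ _ (by positivity), Real.arctan_tan (by linarith) (by linarith)]
    ring

lemma circleAverage_eq_integral_harmonicMeasure [NormedSpace ℝ E] {r : ℝ} (hr : 0 < r) (c : ℂ)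
    (f : ℂ → E) :
    Real.circleAverage f (c + r) r
      = ∫ t : ℝ, f (c + tangentDiscMap r (t * Complex.I)) ∂harmonicMeasure (2 * r) := by
  have hderiv : ∀ t ∈ (Set.univ : Set ℝ), HasDerivWithinAt
      (fun t : ℝ => Real.pi - 2 * Real.arctan (t / (2 * r)))
      (-(2 * (1 / (1 + (t / (2 * r)) ^ 2) * (1 / (2 * r))))) Set.univ t := fun t _ =>
    ((((hasDerivAt_id t).div_const _).arctan.const_mul 2).const_sub _).hasDerivWithinAt
  have hinj : Set.InjOn (fun t : ℝ => Real.pi - 2 * Real.arctan (t / (2 * r))) Set.univ := by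
    intro a _ b _ hab
    have : a / (2 * r) = b / (2 * r) := Real.arctan_injective (by simpa using hab)
    field_simp at this
    exact this
  rw [Real.circleAverage_def, intervalIntegral.integral_of_le (by positivity),
    integral_Ioc_eq_integral_Ioo, ← image_univ_pi_sub_two_mul_arctan hr,
    integral_image_eq_integral_abs_deriv_smul MeasurableSet.univ hderiv hinj, setIntegral_univ,
    ← integral_smul, integral_harmonicMeasure (by simpa using hr)]
  refine integral_congr_ae (ae_of_all _ fun t => ?_)
  simp only [circleMap_pi_sub_two_mul_arctan hr, smul_smul]
  congr 1
  have := Real.pi_pos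
  rw [abs_neg, abs_of_nonneg (by positivity), poissonDensity]
  rw [show (2 * r : ℂ).re = 2 * r by simp, show (2 * r : ℂ).im = 0 by simp, sub_zero]
  field_simp

lemma tangentDiscMap_sub {r : ℝ} (hr : 0 < r) {a b : ℂ} (ha : 0 ≤ a.re) (hb : 0 ≤ b.re) :
    tangentDiscMap r a - tangentDiscMap r b
      = (2 * r) ^ 2 * (a - b) / ((2 * r + a) * (2 * r + b)) := by
  rw [tangentDiscMap, tangentDiscMap,
    div_sub_div _ _ (two_mul_add_ne_zero hr ha) (two_mul_add_ne_zero hr hb)]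
  ring

lemma sq_sub_norm_tangentDiscMap_sub_sq {r : ℝ} (hr : 0 < r) {a : ℂ} (ha : 0 ≤ a.re) :
    r ^ 2 - ‖tangentDiscMap r a - r‖ ^ 2 = 8 * r ^ 3 * a.re / ‖2 * (r : ℂ) + a‖ ^ 2 := by
  have hne := two_mul_add_ne_zero hr ha
  have hsub : tangentDiscMap r a - r = r * (a - 2 * r) / (2 * r + a) := by
    rw [tangentDiscMap, div_sub' hne]
    ring
  rw [hsub, norm_div, norm_mul, div_pow, mul_pow, sub_div' (pow_ne_zero 2 (norm_ne_zero_iff.2 hne))]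
  congr 1
  simp only [Complex.sq_norm, Complex.normSq_apply, Complex.add_re, Complex.sub_re, Complex.mul_re,
    Complex.add_im, Complex.sub_im, Complex.mul_im, Complex.re_ofNat, Complex.im_ofNat,
    Complex.ofReal_re, Complex.ofReal_im]
  ring

lemma poissonDensity_mul_poissonKernel {r : ℝ} (hr : 0 < r) (c : ℂ) {a : ℂ} (ha : 0 < a.re)
    (t : ℝ) :
    poissonDensity (2 * r) t *
        poissonKernel (c + r) (c + tangentDiscMap r a) (c + tangentDiscMap r (t * Complex.I))
      = poissonDensity a t := by
  have hb : (0 : ℝ) ≤ (t * Complex.I).re := by simp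
  have hpole : ‖2 * (r : ℂ) + t * Complex.I‖ ^ 2 = (2 * r) ^ 2 + t ^ 2 := by
    rw [Complex.sq_norm, Complex.normSq_apply]
    simp only [Complex.add_re, Complex.mul_re, Complex.re_ofNat, Complex.ofReal_re,
      Complex.im_ofNat, Complex.ofReal_im, Complex.I_re, Complex.I_im, Complex.add_im,
      Complex.mul_im]
    ring
  have hdist : ‖t * Complex.I - a‖ ^ 2 = a.re ^ 2 + (t - a.im) ^ 2 := by
    rw [Complex.sq_norm, Complex.normSq_apply]
    simp only [Complex.sub_re, Complex.mul_re, Complex.ofReal_re, Complex.I_re, Complex.ofReal_im,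
      Complex.I_im, Complex.sub_im, Complex.mul_im]
    ring
  have hnum : ‖tangentDiscMap r (t * Complex.I) - r‖ ^ 2 - ‖tangentDiscMap r a - r‖ ^ 2
      = 8 * r ^ 3 * a.re / ‖2 * (r : ℂ) + a‖ ^ 2 := by
    have h := sq_sub_norm_tangentDiscMap_sub_sq hr hb
    rw [Complex.re_ofReal_mul, Complex.I_re] at h
    rw [← sq_sub_norm_tangentDiscMap_sub_sq hr ha.le]
    linear_combination -h
  have hden : ‖tangentDiscMap r (t * Complex.I) - tangentDiscMap r a‖ ^ 2
      = (2 * r) ^ 4 * (a.re ^ 2 + (t - a.im) ^ 2) /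
        (((2 * r) ^ 2 + t ^ 2) * ‖2 * (r : ℂ) + a‖ ^ 2) := by
    rw [tangentDiscMap_sub hr hb ha.le, norm_div, norm_mul, norm_mul, div_pow, mul_pow,
      mul_pow ‖2 * (r : ℂ) + t * Complex.I‖, hpole, hdist, norm_pow, norm_mul, Complex.norm_ofNat,
      Complex.norm_real, Real.norm_of_nonneg hr.le, ← pow_mul]
  have hpos : 0 < ‖2 * (r : ℂ) + a‖ := norm_pos_iff.2 (two_mul_add_ne_zero hr ha.le)
  have hre : (2 * r : ℂ).re = 2 * r := by simp
  have him : (2 * r : ℂ).im = 0 := by simp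
  rw [poissonKernel_def, add_sub_add_left_eq_sub, add_sub_add_left_eq_sub, sub_sub_sub_cancel_right,
    hnum, hden, poissonDensity, poissonDensity, hre, him, sub_zero]
  field_simp
  ring

open InnerProductSpace in
lemma apply_tangentDiscMap_eq_integral {u : ℂ → ℝ} {r : ℝ} (hr : 0 < r) (c : ℂ)
    (hu : HarmonicContOnCl u (Metric.ball (c + r) r)) {a : ℂ} (ha : 0 < a.re) :
    u (c + tangentDiscMap r a)
      = ∫ t : ℝ, u (c + tangentDiscMap r (t * Complex.I)) ∂harmonicMeasure a := by
  have hmem : c + tangentDiscMap r a ∈ Metric.ball (c + r : ℂ) r := by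
    rw [Metric.mem_ball, dist_eq_norm, add_sub_add_left_eq_sub, ← sq_lt_sq₀ (norm_nonneg _) hr.le,
      ← sub_pos, sq_sub_norm_tangentDiscMap_sub_sq hr ha.le]
    have : 0 < ‖2 * (r : ℂ) + a‖ := norm_pos_iff.2 (two_mul_add_ne_zero hr ha.le)
    positivity
  rw [← hu.circleAverage_poissonKernel_smul hmem, circleAverage_eq_integral_harmonicMeasure hr,
    integral_harmonicMeasure (by simpa using hr), integral_harmonicMeasure ha]
  refine integral_congr_ae (ae_of_all _ fun t => ?_)
  simp only [Pi.smul_apply', smul_eq_mul, ← mul_assoc, poissonDensity_mul_poissonKernel hr c ha]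

lemma one_add_norm_add_rpow_le {α : ℝ} (hα : 0 ≤ α) (v w : E) :
    (1 + ‖v + w‖) ^ α ≤ (1 + ‖v‖) ^ α * (1 + ‖w‖) ^ α := by
  rw [← Real.mul_rpow (by positivity) (by positivity)]
  gcongr
  nlinarith [norm_add_le v w, mul_nonneg (norm_nonneg v) (norm_nonneg w)]

lemma integrable_one_add_abs_rpow_harmonicMeasure {α : ℝ} (hα : α < 1) (hz : 0 < z.re) :
    Integrable (fun t : ℝ => (1 + |t|) ^ α) (harmonicMeasure z) := by
  refine integrable_harmonicMeasure_of_one hz ((integrable_harmonicMeasure_iff (by simp)).2 ?_)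
  have hdom : Integrable fun t : ℝ => 2 * (1 + ‖t‖) ^ (-(2 - α)) :=
    (integrable_one_add_norm (by simp; linarith)).const_mul 2
  refine hdom.mono' (by unfold poissonDensity; fun_prop) (ae_of_all _ fun t => ?_)
  have hpos : 0 < 1 + |t| := by positivity
  have hdensity : poissonDensity 1 t ≤ 2 * (1 + |t|) ^ (-2 : ℝ) := by
    rw [poissonDensity_one, Real.rpow_neg hpos.le, Real.rpow_two, ← div_eq_mul_inv, inv_eq_one_div,
      div_le_div_iff₀ (by positivity) (by positivity)]
    nlinarith [Real.pi_gt_three, sq_nonneg (1 - |t|), sq_abs t, sq_nonneg t]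
  rw [smul_eq_mul, Real.norm_of_nonneg
    (mul_nonneg (poissonDensity_pos (by simp) t).le (by positivity)), Real.norm_eq_abs]
  calc poissonDensity 1 t * (1 + |t|) ^ α
      ≤ 2 * (1 + |t|) ^ (-2 : ℝ) * (1 + |t|) ^ α := by gcongr
    _ = 2 * (1 + |t|) ^ (-(2 - α)) := by
        rw [mul_assoc, ← Real.rpow_add hpos]
        ring_nf

lemma closedBall_subset_setOf_le_re (x r : ℝ) :
    Metric.closedBall (x + r : ℂ) r ⊆ {w | x ≤ w.re} := by
  intro w hw
  have hre := (Complex.abs_re_le_norm _).trans (mem_closedBall_iff_norm.1 hw)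
  rw [Complex.sub_re, Complex.add_re, Complex.ofReal_re, Complex.ofReal_re] at hre
  rw [Set.mem_ofPred_eq]
  linarith [neg_abs_le (w.re - (x + r))]

lemma abs_apply_add_le {u : ℂ → ℝ} {x C α : ℝ} (hα : 0 ≤ α)
    (hC : ∀ w : ℂ, x ≤ w.re → |u w| ≤ C * (1 + ‖w‖) ^ α) {w : ℂ} (hw : 0 ≤ w.re) :
    |u (x + w)| ≤ |C| * (1 + |x|) ^ α * (1 + ‖w‖) ^ α := by
  calc |u (x + w)| ≤ C * (1 + ‖x + w‖) ^ α := hC _ (by simpa using hw)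
    _ ≤ |C| * (1 + ‖x + w‖) ^ α := by
        gcongr
        exact le_abs_self C
    _ ≤ |C| * ((1 + ‖(x : ℂ)‖) ^ α * (1 + ‖w‖) ^ α) := by
        gcongr
        exact one_add_norm_add_rpow_le hα _ _
    _ = |C| * (1 + |x|) ^ α * (1 + ‖w‖) ^ α := by
        rw [Complex.norm_real, Real.norm_eq_abs, mul_assoc]

open InnerProductSpace in
theorem apply_add_eq_integral_of_growth {u : ℂ → ℝ} {x C α : ℝ}
    (hu : HarmonicOnNhd u {w | x ≤ w.re}) (hα₀ : 0 ≤ α) (hα : α < 1)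
    (hC : ∀ w : ℂ, x ≤ w.re → |u w| ≤ C * (1 + ‖w‖) ^ α) (hz : 0 < z.re) :
    u (x + z) = ∫ t : ℝ, u (x + t * Complex.I) ∂harmonicMeasure z := by
  have hcont {w : ℂ} (hw : 0 ≤ w.re) : ContinuousAt u (x + w) :=
    (hu (x + w) (by simpa using hw)).1.continuousAt
  have hlim {w : ℂ} (hw : 0 ≤ w.re) :
      Tendsto (fun r => u (x + tangentDiscMap r w)) atTop (𝓝 (u (x + w))) :=
    (hcont hw).tendsto.comp ((tendsto_tangentDiscMap hw).const_add _)
  have himI (t : ℝ) : 0 ≤ ((t : ℂ) * Complex.I).re := by simp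
  have hdisc {r : ℝ} (hr : 0 < r) : u (x + tangentDiscMap r z)
      = ∫ t : ℝ, u (x + tangentDiscMap r (t * Complex.I)) ∂harmonicMeasure z := by
    have hsub := closedBall_subset_setOf_le_re x r
    exact apply_tangentDiscMap_eq_integral hr x
      ⟨hu.mono (Metric.ball_subset_closedBall.trans hsub),
        (hu.mono (Metric.closure_ball_subset_closedBall.trans hsub)).continuousOn⟩ hz
  have hcont' {r : ℝ} (hr : 0 < r) :
      Continuous fun t : ℝ => u (x + tangentDiscMap r (t * Complex.I)) :=
    continuous_iff_continuousAt.2 fun t => (hcont (re_tangentDiscMap_nonneg hr (himI t))).comp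
      (f := fun t : ℝ => (x : ℂ) + tangentDiscMap r (t * Complex.I))
      ((continuous_tangentDiscMap_mul_I hr).const_add _).continuousAt
  have hbound {r : ℝ} (hr : 0 < r) (t : ℝ) : ‖u (x + tangentDiscMap r (t * Complex.I))‖
      ≤ |C| * (1 + |x|) ^ α * (1 + |t|) ^ α := by
    refine (abs_apply_add_le hα₀ hC (re_tangentDiscMap_nonneg hr (himI t))).trans ?_
    gcongr
    simpa using norm_tangentDiscMap_le hr (himI t)
  refine tendsto_nhds_unique (hlim hz.le) (Tendsto.congr'
    ((eventually_gt_atTop 0).mono fun r hr => (hdisc hr).symm) ?_)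
  exact tendsto_integral_filter_of_dominated_convergence
    (fun t => |C| * (1 + |x|) ^ α * (1 + |t|) ^ α)
    ((eventually_gt_atTop 0).mono fun r hr => (hcont' hr).aestronglyMeasurable)
    ((eventually_gt_atTop 0).mono fun r hr => ae_of_all _ (hbound hr))
    ((integrable_one_add_abs_rpow_harmonicMeasure hα hz).const_mul _)
    (ae_of_all _ fun t => hlim (himI t))

/-! ### Weak limits of Poisson integrals -/

lemma exists_ultrafilter_tendsto_inner {𝕜 H ι : Type*} [RCLike 𝕜] [NormedAddCommGroup H]
    [InnerProductSpace 𝕜 H] [CompleteSpace H] {l : Filter ι} [l.NeBot] {G : ι → H} {M : ℝ}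
    (hG : ∀ᶠ i in l, ‖G i‖ ≤ M) :
    ∃ U : Ultrafilter ι, ↑U ≤ l ∧
      ∃ Φ : H, ∀ g, Tendsto (fun i => inner 𝕜 (G i) g) U (𝓝 (inner 𝕜 Φ g)) := by
  let U := Ultrafilter.of l
  have hU : ↑U ≤ l := Ultrafilter.of_le l
  let L (i : ι) : WeakDual 𝕜 H := StrongDual.toWeakDual (InnerProductSpace.toDual 𝕜 H (G i))
  have hmem : ∀ᶠ i in (U : Filter ι),
      L i ∈ WeakDual.toStrongDual ⁻¹' Metric.closedBall (0 : StrongDual 𝕜 H) M := by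
    filter_upwards [hU hG] with i hi
    rw [Set.mem_preimage, mem_closedBall_zero_iff]
    exact ((InnerProductSpace.toDual 𝕜 H).norm_map (G i)).trans_le hi
  obtain ⟨ℓ, -, hℓ⟩ := (WeakDual.isCompact_closedBall (𝕜 := 𝕜) (E := H) 0 M).ultrafilter_le_nhds
    (U.map L) (le_principal_iff.2 hmem)
  refine ⟨U, hU, (InnerProductSpace.toDual 𝕜 H).symm (WeakDual.toStrongDual ℓ), fun g => ?_⟩
  rw [InnerProductSpace.toDual_symm_apply]
  exact ((WeakDual.eval_continuous g).tendsto ℓ).comp hℓ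

lemma inner_toLp_eq_integral_mul {X : Type*} [MeasurableSpace X] {μ : Measure X} {f g : X → ℝ}
    (hf : MemLp f 2 μ) (hg : MemLp g 2 μ) :
    inner ℝ hf.toLp hg.toLp = ∫ a, f a * g a ∂μ := by
  rw [L2.inner_def]
  refine integral_congr_ae ?_
  filter_upwards [hf.coeFn_toLp, hg.coeFn_toLp] with a hfa hga
  rw [hfa, hga, RCLike.inner_apply, conj_trivial, mul_comm]

lemma exists_ultrafilter_tendsto_integral_mul {X ι : Type*} [MeasurableSpace X] {μ : Measure X}
    {l : Filter ι} [l.NeBot] {f : ι → X → ℝ} {M : ℝ≥0∞} (hM : M ≠ ∞)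
    (hf : ∀ᶠ i in l, MemLp (f i) 2 μ) (hfM : ∀ᶠ i in l, eLpNorm (f i) 2 μ ≤ M) :
    ∃ U : Ultrafilter ι, ↑U ≤ l ∧ ∃ φ, MemLp φ 2 μ ∧ ∀ g, MemLp g 2 μ →
      Tendsto (fun i => ∫ a, f i a * g a ∂μ) U (𝓝 (∫ a, φ a * g a ∂μ)) := by
  classical
  let G (i : ι) : Lp ℝ 2 μ := if hi : MemLp (f i) 2 μ then hi.toLp else 0
  have hG {i : ι} (hi : MemLp (f i) 2 μ) : G i = hi.toLp := dif_pos hi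
  have hbound : ∀ᶠ i in l, ‖G i‖ ≤ M.toReal := by
    filter_upwards [hf, hfM] with i hi hiM
    rw [hG hi, Lp.norm_toLp]
    exact ENNReal.toReal_mono hM hiM
  obtain ⟨U, hU, Φ, hΦ⟩ := exists_ultrafilter_tendsto_inner (𝕜 := ℝ) hbound
  refine ⟨U, hU, Φ, Lp.memLp Φ, fun g hg => ?_⟩
  rw [← inner_toLp_eq_integral_mul (Lp.memLp Φ) hg, Lp.toLp_coeFn]
  refine (hΦ hg.toLp).congr' ?_
  filter_upwards [hU hf] with i hi
  rw [hG hi, inner_toLp_eq_integral_mul hi hg]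

lemma integral_harmonicMeasure_eq_one (hz : 0 < z.re) (f : ℝ → ℝ) :
    ∫ t, f t ∂harmonicMeasure z =
      ∫ t, f t * (poissonDensity z t / poissonDensity 1 t) ∂harmonicMeasure 1 := by
  rw [integral_harmonicMeasure hz, integral_harmonicMeasure (by simp)]
  congr 1 with t
  have := (poissonDensity_pos (z := 1) (by simp) t).ne'
  simp only [smul_eq_mul]
  field_simp

lemma memLp_poissonDensity_div (hz : 0 < z.re) (p : ℝ≥0∞) :
    MemLp (fun t => poissonDensity z t / poissonDensity 1 t) p (harmonicMeasure 1) := by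
  have hone (t : ℝ) : 0 < poissonDensity 1 t := poissonDensity_pos (by simp) t
  refine MemLp.of_bound ((continuous_poissonDensity hz).div
    (continuous_poissonDensity (by simp)) fun t => (hone t).ne').aestronglyMeasurable
    (z.re * (2 + (1 + 2 * z.im ^ 2) / z.re ^ 2)) (ae_of_all _ fun t => ?_)
  rw [Real.norm_of_nonneg (div_pos (poissonDensity_pos hz t) (hone t)).le, div_le_iff₀ (hone t)]
  exact poissonDensity_le_mul_poissonDensity_one hz hz (by nlinarith [sq_nonneg (t - z.im)])

/-- `u` is the Poisson integral of the boundary function `φ` on the right half-plane. Integrability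
against `harmonicMeasure 1` amounts to integrability against every `harmonicMeasure z`. -/
structure IsPoissonIntegral [NormedSpace ℝ E] (φ : ℝ → E) (u : ℂ → E) : Prop where
  integrable : Integrable φ (harmonicMeasure 1)
  eq_integral : ∀ z ∈ rightHalfPlane, u z = ∫ t, φ t ∂harmonicMeasure z

lemma add_mul_I_mem_rightHalfPlane {x : ℝ} (hx : 0 < x) (y : ℝ) :
    (x + y * Complex.I : ℂ) ∈ rightHalfPlane := by
  simpa [rightHalfPlane] using hx

theorem IsPoissonIntegral.ae_tendsto [NormedSpace ℝ E] [CompleteSpace E] {φ : ℝ → E} {u : ℂ → E}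
    (h : IsPoissonIntegral φ u) :
    ∀ᵐ y : ℝ, Tendsto (fun x : ℝ => u (x + y * Complex.I)) (𝓝[>] 0) (𝓝 (φ y)) := by
  filter_upwards [ae_tendsto_integral_harmonicMeasure h.integrable] with y hy
  refine hy.congr' ?_
  filter_upwards [self_mem_nhdsWithin] with x hx
  exact (h.eq_integral _ (add_mul_I_mem_rightHalfPlane hx y)).symm

lemma continuous_apply_add_mul_I {X : Type*} [TopologicalSpace X] {u : ℂ → X}
    (hu : ContinuousOn u rightHalfPlane) {x : ℝ} (hx : 0 < x) :
    Continuous fun t : ℝ => u (x + t * Complex.I) :=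
  hu.comp_continuous (by fun_prop) (add_mul_I_mem_rightHalfPlane hx)

open InnerProductSpace in
theorem exists_isPoissonIntegral {u : ℂ → ℝ} {α : ℝ} {M : ℝ≥0∞}
    (hu : HarmonicOnNhd u rightHalfPlane) (hα₀ : 0 ≤ α) (hα : α < 1)
    (hgrowth : ∀ x > 0, ∃ C, ∀ w : ℂ, x ≤ w.re → |u w| ≤ C * (1 + ‖w‖) ^ α) (hM : M ≠ ∞)
    (hbound : ∀ᶠ x : ℝ in 𝓝[>] 0,
      eLpNorm (fun t : ℝ => u (x + t * Complex.I)) 2 (harmonicMeasure 1) ≤ M) :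
    ∃ φ, IsPoissonIntegral φ u := by
  have hpos : ∀ᶠ x : ℝ in 𝓝[>] 0, 0 < x := self_mem_nhdsWithin
  have hmemLp : ∀ᶠ x : ℝ in 𝓝[>] 0,
      MemLp (fun t : ℝ => u (x + t * Complex.I)) 2 (harmonicMeasure 1) := by
    filter_upwards [hpos, hbound] with x hx hxM
    exact ⟨(continuous_apply_add_mul_I hu.continuousOn hx).aestronglyMeasurable,
      hxM.trans_lt hM.lt_top⟩
  obtain ⟨U, hU, φ, hφ, hlim⟩ := exists_ultrafilter_tendsto_integral_mul hM hmemLp hbound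
  refine ⟨φ, hφ.integrable one_le_two, fun z hz => ?_⟩
  have htranslate : Tendsto (fun x : ℝ => u (x + z)) (𝓝[>] 0) (𝓝 (u z)) := by
    have hadd : Tendsto (fun x : ℝ => (x : ℂ) + z) (𝓝 0) (𝓝 z) :=
      Continuous.tendsto' (by fun_prop) _ _ (by simp)
    exact (hu z hz).1.continuousAt.tendsto.comp (hadd.mono_left nhdsWithin_le_nhds)
  rw [integral_harmonicMeasure_eq_one hz]
  refine tendsto_nhds_unique (htranslate.mono_left hU) (Tendsto.congr' ?_
    (hlim _ (memLp_poissonDensity_div hz 2)))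
  filter_upwards [hU hpos] with x hx
  obtain ⟨C, hC⟩ := hgrowth x hx
  rw [← integral_harmonicMeasure_eq_one hz, apply_add_eq_integral_of_growth
    (hu.mono fun w hw => lt_of_lt_of_le hx hw) hα₀ hα hC hz]

/-! ### Pointwise bounds in the Hardy space -/

lemma setLIntegral_const_le_setLIntegral_circleMap [NormedSpace ℝ E] {f : ℂ → E} {c : ℂ}
    {r : ℝ} (hf : Real.circleAverage f c r = f c) :
    ∫⁻ _ in Set.Ioo (-Real.pi) Real.pi, ‖f c‖ₑ
      ≤ ∫⁻ θ in Set.Ioo (-Real.pi) Real.pi, ‖f (circleMap c r θ)‖ₑ := by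
  have hmean : ∫ θ in Set.Ioo (-Real.pi) Real.pi, f (circleMap c r θ) = (2 * Real.pi) • f c := by
    rw [← hf, Real.circleAverage_eq_integral_add (-Real.pi),
      intervalIntegral.integral_comp_add_right (fun θ => f (circleMap c r θ)),
      smul_inv_smul₀ (by positivity), zero_add, two_mul, add_neg_cancel_right,
      intervalIntegral.integral_of_le (by linarith [Real.pi_pos]), integral_Ioc_eq_integral_Ioo]
  calc ∫⁻ _ in Set.Ioo (-Real.pi) Real.pi, ‖f c‖ₑ = ‖(2 * Real.pi) • f c‖ₑ := by
        rw [setLIntegral_const, Real.volume_Ioo, enorm_smul, Real.enorm_of_nonneg (by positivity),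
          mul_comm, sub_neg_eq_add, two_mul]
    _ ≤ _ := hmean ▸ enorm_integral_le_lintegral_enorm _

lemma setLIntegral_ball_eq_lintegral_circleMap {g : ℂ → ℝ≥0∞} (hg : Measurable g) (c : ℂ)
    (R : ℝ) :
    ∫⁻ w in Metric.ball c R, g w = ∫⁻ r in Set.Ioo 0 R,
      ENNReal.ofReal r * ∫⁻ θ in Set.Ioo (-Real.pi) Real.pi, g (circleMap c r θ) := by
  have hpolar (p : ℝ × ℝ) : c + Complex.polarCoord.symm p = circleMap c p.1 p.2 := by
    rw [Complex.polarCoord_symm_apply, circleMap, Complex.exp_mul_I, Complex.ofReal_cos,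
      Complex.ofReal_sin]
  have hmem {p : ℝ × ℝ} (hp : 0 < p.1) :
      c + Complex.polarCoord.symm p ∈ Metric.ball c R ↔ p.1 < R := by
    rw [mem_ball_iff_norm, add_sub_cancel_left, Complex.norm_polarCoord_symm, abs_of_pos hp]
  have hmeas : Measurable fun p : ℝ × ℝ =>
      ENNReal.ofReal p.1 * (Metric.ball c R).indicator g (circleMap c p.1 p.2) := by
    have : Measurable fun p : ℝ × ℝ => circleMap c p.1 p.2 := by unfold circleMap; fun_prop
    exact measurable_fst.ennreal_ofReal.mul ((hg.indicator measurableSet_ball).comp this)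
  rw [← lintegral_indicator measurableSet_ball, ← lintegral_add_left_eq_self _ c,
    ← Complex.lintegral_comp_polarCoord_symm, polarCoord_target, Measure.volume_eq_prod,
    ← Measure.prod_restrict]
  simp only [smul_eq_mul, hpolar] at hmem ⊢
  rw [lintegral_prod _ hmeas.aemeasurable, ← Set.Ioi_inter_Iio (a := 0), Set.inter_comm,
    ← setLIntegral_indicator measurableSet_Iio]
  refine setLIntegral_congr_fun measurableSet_Ioi fun r hr => ?_
  dsimp only
  by_cases hrR : r < R
  · simp [Set.indicator_of_mem, hrR, (hmem (p := (r, _)) hr).2, lintegral_const_mul']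
  · simp [hrR, (hmem (p := (r, _)) hr)]

lemma volume_ball_mul_enorm_le_setLIntegral [NormedSpace ℂ E] [CompleteSpace E]
    {f : ℂ → E} {c : ℂ} {R : ℝ} (hf : DifferentiableOn ℂ f (Metric.ball c R)) :
    volume (Metric.ball c R) * ‖f c‖ₑ ≤ ∫⁻ w in Metric.ball c R, ‖f w‖ₑ := by
  have hball : IsOpen (Metric.ball c R) := Metric.isOpen_ball
  let g : ℂ → ℝ≥0∞ := (Metric.ball c R).indicator fun w => ‖f w‖ₑ
  have hg : Measurable g := by
    classical
    have hpiece := hf.continuousOn.enorm.measurable_piecewise (g := 0)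
      continuous_zero.continuousOn hball.measurableSet
    rwa [Set.piecewise_eq_indicator] at hpiece
  have hgball : ∀ w ∈ Metric.ball c R, g w = ‖f w‖ₑ := fun w hw => Set.indicator_of_mem hw _
  have hcircle {r : ℝ} (hr : r ∈ Set.Ioo 0 R) :
      ∫⁻ _ in Set.Ioo (-Real.pi) Real.pi, ‖f c‖ₑ
        ≤ ∫⁻ θ in Set.Ioo (-Real.pi) Real.pi, g (circleMap c r θ) := by
    have hsub : Metric.closedBall c r ⊆ Metric.ball c R := Metric.closedBall_subset_ball hr.2
    have hd : DiffContOnCl ℂ f (Metric.ball c |r|) := by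
      refine (hf.mono ?_).diffContOnCl
      rwa [abs_of_pos hr.1, closure_ball _ hr.1.ne']
    refine (setLIntegral_const_le_setLIntegral_circleMap hd.circleAverage).trans_eq ?_
    refine lintegral_congr fun θ => (hgball _ (hsub ?_)).symm
    exact circleMap_mem_closedBall c hr.1.le θ
  calc volume (Metric.ball c R) * ‖f c‖ₑ = ∫⁻ _ in Metric.ball c R, ‖f c‖ₑ := by
        rw [setLIntegral_const, mul_comm]
    _ = _ := setLIntegral_ball_eq_lintegral_circleMap measurable_const c R
    _ ≤ _ := setLIntegral_mono' measurableSet_Ioo fun r hr => mul_le_mul' le_rfl (hcircle hr)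
    _ = ∫⁻ w in Metric.ball c R, g w := (setLIntegral_ball_eq_lintegral_circleMap hg c R).symm
    _ = _ := setLIntegral_congr_fun hball.measurableSet hgball

lemma setLIntegral_re_preimage_le (s : Set ℝ) (g : ℂ → ℝ≥0∞) :
    ∫⁻ w in Complex.re ⁻¹' s, g w ≤ ∫⁻ x in s, ∫⁻ y : ℝ, g (x + y * Complex.I) := by
  have h := Complex.volume_preserving_equiv_real_prod.symm.setLIntegral_comp_preimage_emb
    Complex.measurableEquivRealProd.symm.measurableEmbedding g (Complex.re ⁻¹' s)
  have hpre : Complex.measurableEquivRealProd.symm ⁻¹' (Complex.re ⁻¹' s) = s ×ˢ Set.univ := by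
    ext p
    simp [Complex.measurableEquivRealProd]
  rw [← h, hpre, Measure.volume_eq_prod, ← Measure.prod_restrict, Measure.restrict_univ]
  refine (lintegral_prod_le _).trans_eq ?_
  simp only [Complex.measurableEquivRealProd_symm_apply, Complex.mk_eq_add_mul_I]

lemma MemHardyTwo.exists_lintegral_le {V : ℂ → ℂ} (hV : MemHardyTwo V) :
    ∃ M : ℝ≥0∞, M ≠ ∞ ∧ ∀ x : ℝ, 0 < x → ∫⁻ y : ℝ, ‖V (x + y * Complex.I)‖ₑ ^ 2 ≤ M :=
  ⟨_, hV.sup_lt_top.ne, fun x hx => le_iSup₂ (f := fun (x : ℝ) (_ : x ∈ Set.Ioi (0 : ℝ)) =>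
    ∫⁻ y : ℝ, ‖V ((x : ℂ) + (y : ℂ) * Complex.I)‖ₑ ^ 2) x hx⟩

lemma ball_subset_re_preimage (c : ℂ) (R : ℝ) :
    Metric.ball c R ⊆ Complex.re ⁻¹' Set.Ioo (c.re - R) (c.re + R) := fun w hw => by
  have hre := (Complex.abs_re_le_norm (w - c)).trans_lt (mem_ball_iff_norm.1 hw)
  rw [Complex.sub_re, abs_lt] at hre
  exact ⟨by linarith, by linarith⟩

lemma MemHardyTwo.exists_norm_le {V : ℂ → ℂ} (hV : MemHardyTwo V) {x : ℝ} (hx : 0 < x) :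
    ∃ C : ℝ, ∀ w : ℂ, x ≤ w.re → ‖V w‖ ≤ C := by
  obtain ⟨M, hM, hVM⟩ := hV.exists_lintegral_le
  set A := volume (Metric.ball (0 : ℂ) x) with hA
  have hA0 : A ≠ 0 := (Metric.measure_ball_pos _ _ hx).ne'
  have hAtop : A ≠ ∞ := measure_ball_lt_top.ne
  set Q := M * ENNReal.ofReal (2 * x) / A
  have hQtop : Q ≠ ∞ := ENNReal.div_ne_top (ENNReal.mul_ne_top hM ENNReal.ofReal_ne_top) hA0
  refine ⟨√Q.toReal, fun w hw => Real.le_sqrt_of_sq_le ?_⟩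
  have hpos : ∀ v ∈ Complex.re ⁻¹' Set.Ioo (w.re - x) (w.re + x), 0 < v.re :=
    fun v hv => by linarith [hv.1]
  have hd : DifferentiableOn ℂ (fun v => V v ^ 2) (Metric.ball w x) :=
    (hV.analytic.differentiableOn.mono fun v hv => hpos v (ball_subset_re_preimage w x hv)).pow 2
  have harea : A * ‖V w‖ₑ ^ 2 ≤ M * ENNReal.ofReal (2 * x) := calc
    A * ‖V w‖ₑ ^ 2 = volume (Metric.ball w x) * ‖V w ^ 2‖ₑ := by
        rw [hA, Measure.addHaar_ball_center volume w, enorm_pow]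
    _ ≤ ∫⁻ v in Metric.ball w x, ‖V v ^ 2‖ₑ := volume_ball_mul_enorm_le_setLIntegral hd
    _ ≤ ∫⁻ v in Complex.re ⁻¹' Set.Ioo (w.re - x) (w.re + x), ‖V v ^ 2‖ₑ :=
        lintegral_mono_set (ball_subset_re_preimage w x)
    _ ≤ ∫⁻ s in Set.Ioo (w.re - x) (w.re + x), ∫⁻ y : ℝ, ‖V (s + y * Complex.I) ^ 2‖ₑ :=
        setLIntegral_re_preimage_le _ _
    _ ≤ ∫⁻ _ in Set.Ioo (w.re - x) (w.re + x), M :=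
        setLIntegral_mono' measurableSet_Ioo fun s hs => by
          simpa only [enorm_pow] using hVM s (by linarith [hs.1])
    _ = M * ENNReal.ofReal (2 * x) := by
        rw [setLIntegral_const, Real.volume_Ioo]
        ring_nf
  have hle : ‖V w‖ₑ ^ 2 ≤ Q := (ENNReal.le_div_iff_mul_le (.inl hA0) (.inl hAtop)).2
    ((mul_comm _ _).trans_le harea)
  simpa using ENNReal.toReal_mono hQtop hle

lemma MemHardyTwo.exists_eLpNorm_harmonicMeasure_one_le {V : ℂ → ℂ} (hV : MemHardyTwo V) :
    ∃ M : ℝ≥0∞, M ≠ ∞ ∧ ∀ x : ℝ, 0 < x →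
      eLpNorm (fun t : ℝ => V (x + t * Complex.I)) 2 (harmonicMeasure 1) ≤ M := by
  obtain ⟨M, hM, hVM⟩ := hV.exists_lintegral_le
  refine ⟨M ^ (1 / 2 : ℝ), ENNReal.rpow_ne_top_of_nonneg (by norm_num) hM, fun x hx => ?_⟩
  refine (eLpNorm_mono_measure _ harmonicMeasure_one_le_volume).trans ?_
  rw [eLpNorm_eq_lintegral_rpow_enorm_toReal two_ne_zero ENNReal.ofNat_ne_top]
  simp only [ENNReal.toReal_ofNat, ENNReal.rpow_ofNat]
  gcongr
  exact hVM x hx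

lemma memLp_one_add_abs_rpow_harmonicMeasure_one {α : ℝ} (hα : α < 1 / 2) :
    MemLp (fun t : ℝ => (1 + |t|) ^ α) 2 (harmonicMeasure 1) := by
  have hcont : Continuous fun t : ℝ => (1 + |t|) ^ α :=
    Continuous.rpow_const (by fun_prop) fun t => .inl (by positivity)
  rw [memLp_two_iff_integrable_sq hcont.aestronglyMeasurable]
  have hsq (t : ℝ) : ((1 + |t|) ^ α) ^ 2 = (1 + |t|) ^ (α * 2) := by
    rw [Real.rpow_mul (by positivity), Real.rpow_two]
  simp only [hsq]
  exact integrable_one_add_abs_rpow_harmonicMeasure (by linarith) (by simp)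

lemma exists_abs_le_mul_rpow_of_memHardyTwo {V W : ℂ → ℂ} (hV : MemHardyTwo V) (hW : MemHardyTwo W)
    {u : ℂ → ℝ} {K α x : ℝ} (hα : 0 ≤ α)
    (hle : ∀ z ∈ rightHalfPlane, |u z| ≤ ‖V z‖ + ‖W z‖ + K * (1 + ‖z‖) ^ α) (hx : 0 < x) :
    ∃ C, ∀ w : ℂ, x ≤ w.re → |u w| ≤ C * (1 + ‖w‖) ^ α := by
  obtain ⟨A, hA⟩ := hV.exists_norm_le hx
  obtain ⟨B, hB⟩ := hW.exists_norm_le hx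
  refine ⟨A + B + K, fun w hw => ?_⟩
  have hone : 1 ≤ (1 + ‖w‖) ^ α := Real.one_le_rpow (by linarith [norm_nonneg w]) hα
  have hAB : 0 ≤ A + B :=
    add_nonneg ((norm_nonneg _).trans (hA w hw)) ((norm_nonneg _).trans (hB w hw))
  calc |u w| ≤ ‖V w‖ + ‖W w‖ + K * (1 + ‖w‖) ^ α := hle w (hx.trans_le hw)
    _ ≤ (A + B) * 1 + K * (1 + ‖w‖) ^ α := by linarith [hA w hw, hB w hw]
    _ ≤ (A + B) * (1 + ‖w‖) ^ α + K * (1 + ‖w‖) ^ α := by gcongr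
    _ = (A + B + K) * (1 + ‖w‖) ^ α := by ring

lemma exists_eLpNorm_le_of_memHardyTwo {V W : ℂ → ℂ} (hV : MemHardyTwo V) (hW : MemHardyTwo W)
    {u : ℂ → ℝ} {K α : ℝ} (hα₀ : 0 ≤ α) (hα : α < 1 / 2)
    (hle : ∀ z ∈ rightHalfPlane, |u z| ≤ ‖V z‖ + ‖W z‖ + K * (1 + ‖z‖) ^ α) :
    ∃ M : ℝ≥0∞, M ≠ ∞ ∧ ∀ x ∈ Set.Ioo (0 : ℝ) 1,
      eLpNorm (fun t : ℝ => u (x + t * Complex.I)) 2 (harmonicMeasure 1) ≤ M := by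
  obtain ⟨A, hA, hVA⟩ := hV.exists_eLpNorm_harmonicMeasure_one_le
  obtain ⟨B, hB, hWB⟩ := hW.exists_eLpNorm_harmonicMeasure_one_le
  have hG := (memLp_one_add_abs_rpow_harmonicMeasure_one hα).const_mul (|K| * (1 + 1) ^ α)
  set G := fun t : ℝ => |K| * (1 + 1) ^ α * (1 + |t|) ^ α
  refine ⟨A + B + eLpNorm G 2 (harmonicMeasure 1),
    ENNReal.add_ne_top.2 ⟨ENNReal.add_ne_top.2 ⟨hA, hB⟩, hG.2.ne⟩, fun x hx => ?_⟩
  have hmeas {F : ℂ → ℂ} (hF : MemHardyTwo F) : AEStronglyMeasurable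
      (fun t : ℝ => ‖F (x + t * Complex.I)‖) (harmonicMeasure 1) :=
    (continuous_apply_add_mul_I hF.analytic.continuousOn hx.1).norm.aestronglyMeasurable
  have hdom (t : ℝ) : ‖u (x + t * Complex.I)‖
      ≤ ‖V (x + t * Complex.I)‖ + ‖W (x + t * Complex.I)‖ + G t := by
    refine (hle _ (add_mul_I_mem_rightHalfPlane hx.1 t)).trans (add_le_add_right ?_ _)
    calc K * (1 + ‖x + t * Complex.I‖) ^ α
        ≤ |K| * ((1 + ‖(x : ℂ)‖) ^ α * (1 + ‖t * Complex.I‖) ^ α) := by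
          gcongr
          · exact le_abs_self K
          · exact one_add_norm_add_rpow_le hα₀ _ _
      _ ≤ |K| * ((1 + 1) ^ α * (1 + |t|) ^ α) := by
          gcongr
          · simpa [abs_of_pos hx.1] using hx.2.le
          · simp
      _ = G t := (mul_assoc _ _ _).symm
  refine (eLpNorm_mono_real hdom).trans <|
    (eLpNorm_add_le ((hmeas hV).add (hmeas hW)) hG.1 one_le_two).trans <| add_le_add_left
      ((eLpNorm_add_le (hmeas hV) (hmeas hW) one_le_two).trans (add_le_add ?_ ?_)) _
  · exact (eLpNorm_norm _).trans_le (hVA x hx.1)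
  · exact (eLpNorm_norm _).trans_le (hWB x hx.1)

open InnerProductSpace in
theorem exists_isPoissonIntegral_of_memHardyTwo {V W : ℂ → ℂ} (hV : MemHardyTwo V)
    (hW : MemHardyTwo W) {u : ℂ → ℝ} (hu : HarmonicOnNhd u rightHalfPlane) {K α : ℝ}
    (hα₀ : 0 ≤ α) (hα : α < 1 / 2)
    (hle : ∀ z ∈ rightHalfPlane, |u z| ≤ ‖V z‖ + ‖W z‖ + K * (1 + ‖z‖) ^ α) :
    ∃ φ, IsPoissonIntegral φ u := by
  obtain ⟨M, hM, hbound⟩ := exists_eLpNorm_le_of_memHardyTwo hV hW hα₀ hα hle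
  exact exists_isPoissonIntegral hu hα₀ (by linarith)
    (fun x hx => exists_abs_le_mul_rpow_of_memHardyTwo hV hW hα₀ hle hx) hM
    (eventually_of_mem (Ioo_mem_nhdsGT one_pos) hbound)

theorem MemHardyTwo.ae_tendsto_boundaryValue {V : ℂ → ℂ} (hV : MemHardyTwo V) :
    ∀ᵐ y : ℝ, Tendsto (fun x : ℝ => V (x + y * Complex.I)) (𝓝[>] 0) (𝓝 (boundaryValue V y)) := by
  have hpart {u : ℂ → ℝ} (hu : InnerProductSpace.HarmonicOnNhd u rightHalfPlane)
      (hle : ∀ z, |u z| ≤ ‖V z‖) : ∃ φ, IsPoissonIntegral φ u :=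
    exists_isPoissonIntegral_of_memHardyTwo hV hV hu le_rfl one_half_pos (K := 0)
      fun z _ => by linarith [hle z, norm_nonneg (V z)]
  obtain ⟨φ, hφ⟩ := hpart (fun z hz => (hV.analytic z hz).harmonicAt_re)
    fun z => Complex.abs_re_le_norm _
  obtain ⟨ψ, hψ⟩ := hpart (fun z hz => (hV.analytic z hz).harmonicAt_im)
    fun z => Complex.abs_im_le_norm _
  filter_upwards [hφ.ae_tendsto, hψ.ae_tendsto] with y hre him
  refine tendsto_nhds_limUnder ⟨φ y + ψ y * Complex.I, ?_⟩
  simpa only [Complex.re_add_im] using hre.ofReal.add (him.ofReal.mul_const Complex.I)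

/-! ### Outer functions -/

/-- The Schwarz kernel of the right half-plane at the boundary point `it`, with real part the
Poisson kernel. The term `it / (1 + t²)`, which does not depend on `z`, makes the kernel decay like
`1 / (1 + t²)` without affecting the real part. -/
def schwarzKernel (z : ℂ) (t : ℝ) : ℂ :=
  (1 / (z - t * Complex.I) - t * Complex.I / (1 + (t : ℂ) ^ 2)) / (Real.pi : ℂ)

lemma re_schwarzKernel (z : ℂ) (t : ℝ) : (schwarzKernel z t).re = poissonDensity z t := by
  have himag : (t * Complex.I / (1 + (t : ℂ) ^ 2)).re = 0 := by
    rw [mul_div_right_comm, Complex.mul_I_re, neg_eq_zero]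
    exact_mod_cast Complex.ofReal_im (t / (1 + t ^ 2))
  rw [schwarzKernel, Complex.div_ofReal_re, Complex.sub_re, himag, sub_zero, one_div,
    Complex.inv_re, poissonDensity, Complex.normSq_apply, div_div]
  simp only [Complex.sub_re, Complex.mul_re, Complex.ofReal_re, Complex.I_re, mul_zero,
    Complex.ofReal_im, Complex.I_im, mul_one, sub_self, sub_zero, Complex.sub_im, Complex.mul_im,
    add_zero]
  ring

lemma re_le_norm_sub_mul_I (z : ℂ) (t : ℝ) : z.re ≤ ‖z - t * Complex.I‖ := by
  simpa using Complex.re_le_norm (z - t * Complex.I)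

lemma sub_mul_I_ne_zero (hz : 0 < z.re) (t : ℝ) : z - t * Complex.I ≠ 0 :=
  norm_pos_iff.1 (hz.trans_le (re_le_norm_sub_mul_I z t))

lemma schwarzKernel_eq_mul (hz : 0 < z.re) (t : ℝ) :
    schwarzKernel z t = poissonDensity 1 t * (z + (1 - z ^ 2) / (z - t * Complex.I)) := by
  have hpole := sub_mul_I_ne_zero hz t
  have hden : (1 : ℂ) + (t : ℂ) ^ 2 ≠ 0 := by
    exact_mod_cast (show (0 : ℝ) < 1 + t ^ 2 by positivity).ne'
  have hpi : (Real.pi : ℂ) ≠ 0 := by exact_mod_cast Real.pi_ne_zero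
  rw [schwarzKernel, poissonDensity_one]
  push_cast
  field_simp
  linear_combination (t : ℂ) ^ 2 * Complex.I_sq

lemma integrable_ofReal_mul_schwarzKernel (hz : 0 < z.re) {f : ℝ → ℝ}
    (hf : Integrable f (harmonicMeasure 1)) :
    Integrable fun t => (f t : ℂ) * schwarzKernel z t := by
  have hcont : Continuous fun t : ℝ => z + (1 - z ^ 2) / (z - t * Complex.I) :=
    continuous_const.add (continuous_const.div (by fun_prop) (sub_mul_I_ne_zero hz))
  have hbdd (t : ℝ) : ‖z + (1 - z ^ 2) / (z - t * Complex.I)‖ ≤ ‖z‖ + ‖1 - z ^ 2‖ / z.re := by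
    refine (norm_add_le _ _).trans ?_
    rw [norm_div]
    gcongr
    exact re_le_norm_sub_mul_I z t
  refine ((integrable_harmonicMeasure_iff (by simp)).1
    (hf.ofReal (𝕜 := ℂ) |>.mul_bdd hcont.aestronglyMeasurable (ae_of_all _ hbdd))).congr
    (ae_of_all _ fun t => ?_)
  dsimp only
  rw [schwarzKernel_eq_mul hz, Complex.real_smul]
  exact mul_left_comm _ _ _

lemma outerPart_eq_exp_integral (V : ℂ → ℂ) (z : ℂ) : outerPart V z =
    Complex.exp (∫ t, (Real.log ‖boundaryValue V t‖ : ℂ) * schwarzKernel z t) := by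
  simp only [outerPart, schwarzKernel, mul_div_assoc]

lemma norm_outerPart {V : ℂ → ℂ}
    (hV : Integrable (fun t => Real.log ‖boundaryValue V t‖) (harmonicMeasure 1))
    (hz : 0 < z.re) :
    ‖outerPart V z‖ = Real.exp (∫ t, Real.log ‖boundaryValue V t‖ ∂harmonicMeasure z) := by
  rw [outerPart_eq_exp_integral, Complex.norm_exp, ← Complex.reCLM_apply,
    ← Complex.reCLM.integral_comp_comm (integrable_ofReal_mul_schwarzKernel hz hV),
    integral_harmonicMeasure hz]
  simp only [Complex.reCLM_apply, Complex.re_ofReal_mul, re_schwarzKernel, smul_eq_mul,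
    mul_comm (Real.log _)]

theorem isOuterFunction_of_isPoissonIntegral_log_norm {V : ℂ → ℂ} {φ : ℝ → ℝ}
    (hV : AnalyticOnNhd ℂ V rightHalfPlane) (hV0 : ∀ z ∈ rightHalfPlane, V z ≠ 0)
    (hlim : ∀ᵐ y : ℝ,
      Tendsto (fun x : ℝ => V (x + y * Complex.I)) (𝓝[>] 0) (𝓝 (boundaryValue V y)))
    (hφ : IsPoissonIntegral φ fun z => Real.log ‖V z‖) : IsOuterFunction V := by
  have hnorm : ∀ᵐ y : ℝ, ‖boundaryValue V y‖ = Real.exp (φ y) := by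
    filter_upwards [hlim, hφ.ae_tendsto] with y hy hlogy
    refine tendsto_nhds_unique hy.norm (hlogy.rexp.congr' ?_)
    filter_upwards [self_mem_nhdsWithin] with x hx
    exact Real.exp_log (norm_pos_iff.2 (hV0 _ (add_mul_I_mem_rightHalfPlane hx y)))
  have hlog : (fun y => Real.log ‖boundaryValue V y‖) =ᵐ[volume] φ := by
    filter_upwards [hnorm] with y hy
    rw [hy, Real.log_exp]
  have hint : Integrable (fun y => Real.log ‖boundaryValue V y‖) (harmonicMeasure 1) :=
    hφ.integrable.congr (harmonicMeasure_absolutelyContinuous (by simp) |>.ae_eq hlog.symm)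
  refine ⟨hV, hlim, ?_, ?_, fun z hz => ?_⟩
  · filter_upwards [hnorm] with y hy
    rw [← norm_pos_iff, hy]
    exact Real.exp_pos _
  · refine (((integrable_harmonicMeasure_iff (by simp)).1 hint).const_mul Real.pi).congr
      (ae_of_all _ fun y => ?_)
    dsimp only
    rw [poissonDensity_one, smul_eq_mul]
    field_simp
  · rw [norm_outerPart hint hz, ← Real.exp_log (norm_pos_iff.2 (hV0 z hz)), hφ.eq_integral z hz]
    exact congrArg _ (integral_congr_ae
      (harmonicMeasure_absolutelyContinuous hz |>.ae_eq hlog.symm))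

lemma abs_log_le_add {a b c : ℝ} (ha : 0 ≤ a) (hb : 0 ≤ b) (hc : 0 ≤ c)
    (h : Real.exp (-c) ≤ a * b) : |Real.log a| ≤ a + b + c := by
  have hab : 0 < a * b := (Real.exp_pos _).trans_le h
  have hlog : -c ≤ Real.log a + Real.log b := by
    rw [← Real.log_mul (left_ne_zero_of_mul hab.ne') (right_ne_zero_of_mul hab.ne')]
    exact (Real.le_log_iff_exp_le hab).2 h
  rw [abs_le]
  constructor <;> linarith [Real.log_le_self ha, Real.log_le_self hb]

lemma ne_zero_of_continuousAt_div {V g : ℂ → ℂ} {s : Set ℂ} (hs : IsPreconnected s)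
    (hV : AnalyticOnNhd ℂ V s) (hV0 : ∃ z ∈ s, V z ≠ 0) (hg : ∀ z ∈ s, ContinuousAt g z)
    (hg0 : ∀ z ∈ s, g z ≠ 0) (hgV : ∀ z ∈ s, ContinuousAt (fun w => g w / V w) z) :
    ∀ z ∈ s, V z ≠ 0 := by
  intro z hz hVz
  have hne : ∀ᶠ w in 𝓝[≠] z, V w ≠ 0 := by
    refine (hV z hz).eventually_eq_zero_or_eventually_ne_zero.resolve_left fun hzero => ?_
    obtain ⟨a, ha, hVa⟩ := hV0
    exact hVa (hV.eqOn_zero_of_preconnected_of_eventuallyEq_zero hs hz hzero ha)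
  have heq : (fun w => V w * (g w / V w)) =ᶠ[𝓝 z] g :=
    (((hV z hz).continuousAt.mul (hgV z hz)).eventuallyEq_nhds_iff_eventuallyEq_nhdsNE
      (hg z hz)).1 (hne.mono fun w hw => mul_div_cancel₀ _ hw)
  exact hg0 z hz (by rw [← heq.eq_of_nhds, hVz, zero_mul])

lemma one_add_ne_zero (hz : z ∈ rightHalfPlane) : 1 + z ≠ 0 := fun h => by
  have hre : 1 + z.re = 0 := by simpa using congrArg Complex.re h
  linarith [show 0 < z.re from hz]

lemma ne_zero_of_analyticOnNhd_zpow_div {V : ℂ → ℂ} {m : ℤ}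
    (hV : AnalyticOnNhd ℂ V rightHalfPlane) (hV0 : ∃ z ∈ rightHalfPlane, V z ≠ 0)
    (hW : AnalyticOnNhd ℂ (fun z => (1 + z) ^ m / V z) rightHalfPlane) :
    ∀ z ∈ rightHalfPlane, V z ≠ 0 :=
  ne_zero_of_continuousAt_div (convex_halfSpace_re_gt 0).isPreconnected hV hV0
    (fun _ hz => (continuousAt_const.add continuousAt_id).zpow₀ _ (.inl (one_add_ne_zero hz)))
    (fun _ hz => zpow_ne_zero _ (one_add_ne_zero hz)) fun z hz => (hW z hz).continuousAt

lemma exp_neg_le_norm_one_add_zpow (n : ℕ) (hz : z ∈ rightHalfPlane) :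
    Real.exp (-(4 * n * (1 + ‖z‖) ^ (1 / 4 : ℝ))) ≤ ‖(1 + z) ^ (-(n : ℤ))‖ := by
  have hpos : 0 < ‖1 + z‖ := norm_pos_iff.2 (one_add_ne_zero hz)
  have hlog : Real.log ‖1 + z‖ ≤ 4 * (1 + ‖z‖) ^ (1 / 4 : ℝ) := by
    have hle : ‖1 + z‖ ≤ 1 + ‖z‖ := by simpa using norm_add_le 1 z
    have hrpow := Real.log_le_rpow_div (x := 1 + ‖z‖) (ε := 1 / 4) (by positivity) (by norm_num)
    linarith [Real.log_le_log hpos hle]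
  rw [norm_zpow, zpow_neg, zpow_natCast, ← Real.exp_log (inv_pos.2 (pow_pos hpos n)),
    Real.log_inv, Real.log_pow, Real.exp_le_exp, neg_le_neg_iff]
  calc n * Real.log ‖1 + z‖ ≤ n * (4 * (1 + ‖z‖) ^ (1 / 4 : ℝ)) := by gcongr
    _ = 4 * n * (1 + ‖z‖) ^ (1 / 4 : ℝ) := by ring

end

theorem proposition2p4_general {V W : ℂ → ℂ} (hV : MemHardyTwo V) (hW : MemHardyTwo W) {K α : ℝ}
    (hα₀ : 0 ≤ α) (hα : α < 1 / 2)
    (hVW : ∀ z ∈ rightHalfPlane, Real.exp (-(K * (1 + ‖z‖) ^ α)) ≤ ‖V z * W z‖) :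
    IsOuterFunction V := by
  have hV0 : ∀ z ∈ rightHalfPlane, V z ≠ 0 := fun z hz =>
    left_ne_zero_of_mul (norm_pos_iff.1 ((Real.exp_pos _).trans_le (hVW z hz)))
  have hlog : ∀ z ∈ rightHalfPlane,
      |Real.log ‖V z‖| ≤ ‖V z‖ + ‖W z‖ + |K| * (1 + ‖z‖) ^ α := fun z hz => by
    refine abs_log_le_add (norm_nonneg _) (norm_nonneg _) (by positivity) ?_
    rw [← norm_mul]
    refine (Real.exp_le_exp.2 (neg_le_neg ?_)).trans (hVW z hz)
    gcongr
    exact le_abs_self K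
  obtain ⟨φ, hφ⟩ := exists_isPoissonIntegral_of_memHardyTwo hV hW
    (fun z hz => (hV.analytic z hz).harmonicAt_log_norm (hV0 z hz)) hα₀ hα hlog
  exact isOuterFunction_of_isPoissonIntegral_log_norm hV.analytic hV0 hV.ae_tendsto_boundaryValue hφ

theorem proposition2p4 (V : ℂ → ℂ) (n : ℕ)
    (hV : MemHardyTwo V)
    (hV0 : ∃ z ∈ rightHalfPlane, V z ≠ 0)
    (hW : MemHardyTwo (fun z : ℂ => (1 + z) ^ (-(n : ℤ)) / V z)) :
    IsOuterFunction V := by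
  refine proposition2p4_general hV hW (K := 4 * n) (α := 1 / 4) (by norm_num) (by norm_num)
    fun z hz => ?_
  rw [mul_div_cancel₀ _ (ne_zero_of_analyticOnNhd_zpow_div hV.analytic hV0 hW.analytic z hz)]
  exact exp_neg_le_norm_one_add_zpow n hz
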